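/- **Setting.** Let $l,n\ge 0$ be integers and let a fully connected network have layer widths $d_0,\dots,d_{l+1}$ with $d_{l+1}=d_0=m$, and twice continuously differentiable activation maps $g^{(1)},\dots,g^{(l+1)}$ (scalar functions acting entrywise, or more generally $C^2$ maps $g^{(j)}:\mathbb R^{d_j}\to\mathbb R^{d_j}$). Let $X=[x_1,\dots,x_n]\in\mathbb R^{m\times n}$, let $\Omega$ be a set of (observed) positions with $0$-$1$ mask $N$, and let $\theta=(W^{(1)},\dots,W^{(l+1)},b^{(1)},\dots,b^{(l+1)})$, $z_q^{(0)}=x_q$, $z_q^{(j)}=g^{(j)}(W^{(j)}z_q^{(j-1)}+b^{(j)})$, $\widehat X=[z_1^{(l+1)},\dots,z_n^{(l+1)}]$. For fixed $\lambda,\mu_{h^{(i)}},\mu_{v^{(j)}},M>0$ and $\alpha_i,\beta_j\ge 0$ put $$g(h,V,\theta)=\|N\odot(X-\widehat X)\|_F^2+\lambda\sum_{j=1}^{l+1}\|W^{(j)}\|_F^2+\sum_{q=1}^n\sum_{i=1}^l\tfrac1{2\mu_{h^{(i)}}}\|z_q^{(i)}-h_q^{(i)}\|^2+\sum_{j=1}^{l+1}\tfrac1{2\mu_{v^{(j)}}}\|W^{(j)}-V^{(j)}\|_F^2,$$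 $r_h(h_q^{(i)})=\alpha_i\|h_q^{(i)}\|_1$, $r_v(V^{(j)})=\beta_j\|V^{(j)}\|_*$ (nuclear norm), $r_\theta(\theta)=0$ if $\|\theta\|_\infty\le M$ and $+\infty$ otherwise, and $$Q(h,V,\theta)=g(h,V,\theta)+\sum_{q,i}r_h(h_q^{(i)})+\sum_j r_v(V^{(j)})+r_\theta(\theta).$$ Write $\mathrm{Prox}_{s,r}(x)=\arg\min_u\, r(u)+\frac1{2s}\|u-x\|^2$. **Algorithm.** Fix $\gamma>1$ and $\delta_{\max}<1$. Starting from arbitrary $h_0,V_0,\theta_0$ and $\theta_{-1}=\theta_0$, epoch $k=1,2,\dots$ performs, for $q=1,\dots,n$ and $i=1,\dots,l$ in lexicographic order, then for $j=1,\dots,l+1$ in order, and finally for $\theta$, $$h_{q,k}^{(i)}=\mathrm{Prox}_{\mu_{h^{(i)},k},\,r_h}\bigl(h_{q,k-1}^{(i)}-\mu_{h^{(i)},k}\nabla_{h_q^{(i)}}g\bigr),\qquad V_k^{(j)}=\mathrm{Prox}_{\mu_{v^{(j)},k},\,r_v}\bigl(V_{k-1}^{(j)}-\mu_{v^{(j)},k}\nabla_{V^{(j)}}g\bigr),$$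 $$\widehat\theta_{k-1}=\theta_{k-1}+\omega_{\theta,k}(\theta_{k-1}-\theta_{k-2}),\qquad \theta_k=\mathrm{Prox}_{\mu_{\theta,k},\,r_\theta}\bigl(\widehat\theta_{k-1}-\mu_{\theta,k}\nabla_\theta g(h_k,V_k,\widehat\theta_{k-1})\bigr),$$ where the first two gradients are taken at the most recent values of all the blocks ($\theta=\theta_{k-1}$). The step sizes satisfy $\mu_{h^{(i)}}^{\min}\le\mu_{h^{(i)},k}\le\mu_{h^{(i)}}$, $\mu_{v^{(j)}}^{\min}\le\mu_{v^{(j)},k}\le\mu_{v^{(j)}}$ and $\mu_\theta^{\min}\le\mu_{\theta,k}=\frac1{\gamma L_{\theta,k}}\le\mu_\theta^{\max}$ with positive constants $\mu^{\min}$ and finite $\mu_\theta^{\max}$, where $L_{\theta,k}>0$ for all $k\ge0$ and, for $k\ge1$, $L_{\theta,k}$ is a Lipschitz constant of $\nabla_\theta g(h_k,V_k,\cdot)$ on $\{\|\theta\|_\infty\le M\}\cup\{\widehat\theta_{k-1}\}$; the extrapolation weights satisfy $0\le\omega_{\theta,k}\le\frac{\gamma-1}{2(\gamma+1)}\sqrt{\delta_k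 L_{\theta,k-1}/L_{\theta,k}}$ with $0\le\delta_k\le\delta_{\max}$. **Theorem 1 (Subsequence convergence).** Let $\{(h_k,V_k,\theta_k)\}_{k\ge0}$ be a bounded infinite sequence generated in this way. Then: (a) The sequence has a (finite) limit point. (b) If a subsequence indexed by $\mathcal I$ converges to $(\bar h,\bar V,\bar\theta)$, then, as $\mathcal I\ni k\to\infty$, $r_h(h_{q,k}^{(i)})\to r_h(\bar h_q^{(i)})$ for all $q,i$, $r_v(V_k^{(j)})\to r_v(\bar V^{(j)})$ for all $j$, and $r_\theta(\theta_k)\to r_\theta(\bar\theta)$. (c) Every limit point of the sequence is a critical point of $Q$, i.e. $0$ belongs to the limiting subdifferential of $Q$ there. (d) If a subsequence indexed by $\mathcal I$ converges to $(\bar h,\bar V,\bar\theta)$, then $Q(h_k,V_k,\theta_k)\to Q(\bar h,\bar V,\bar\theta)$ as $\mathcal I\ni k\to\infty$. -/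

import Mathlib

open Filter Topology

noncomputable section

namespace DNNNSR

/-! ### Proximal operator, limiting subdifferential, critical points -/

section Variational

variable {E : Type*} [NormedAddCommGroup E] [InnerProductSpace ℝ E]

/-- `y` is a value at `x` of the proximal operator of `r` with step size `s`:
`y ∈ argmin_u  r u + ‖u - x‖² / (2 s)`. -/
def IsProx (r : E → EReal) (s : ℝ) (x y : E) : Prop :=
  ∀ u : E, r y + ((‖y - x‖ ^ 2 / (2 * s) : ℝ) : EReal)
    ≤ r u + ((‖u - x‖ ^ 2 / (2 * s) : ℝ) : EReal)

/-- Fréchet (regular) subdifferential of `f` at `x`: `f x` is finite and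
`liminf_{y → x} (f y - f x - ⟪v, y - x⟫) / ‖y - x‖ ≥ 0`. -/
def frechetSubdiff (f : E → EReal) (x : E) : Set E :=
  {v | f x ≠ ⊤ ∧ f x ≠ ⊥ ∧ ∀ ε : ℝ, 0 < ε → ∀ᶠ y in 𝓝 x,
    f x + ((inner ℝ v (y - x) - ε * ‖y - x‖ : ℝ) : EReal) ≤ f y}

/-- Limiting (Mordukhovich) subdifferential of `f` at `x`. -/
def limitingSubdiff (f : E → EReal) (x : E) : Set E :=
  {v | f x ≠ ⊤ ∧ f x ≠ ⊥ ∧ ∃ (xs vs : ℕ → E),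
    Tendsto xs atTop (𝓝 x) ∧ Tendsto (fun k => f (xs k)) atTop (𝓝 (f x)) ∧
    (∀ k, vs k ∈ frechetSubdiff f (xs k)) ∧ Tendsto vs atTop (𝓝 v)}

/-- Critical point: `0` belongs to the limiting subdifferential. -/
def IsCriticalPt (f : E → EReal) (x : E) : Prop :=
  (0 : E) ∈ limitingSubdiff f x

end Variational

/-! ### Spaces of variables -/

/-- `ℝ^a` with the Euclidean norm. -/
abbrev Vec (a : ℕ) : Type := EuclideanSpace ℝ (Fin a)

/-- `ℝ^{a × b}` with the Frobenius norm and inner product. -/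
abbrev Mat (a b : ℕ) : Type := EuclideanSpace ℝ (Fin a × Fin b)

/-- The nuclear norm: the sum of the singular values of the matrix (those with index at least
the number of columns vanish). -/
def nuclearNorm {a b : ℕ} (A : Mat a b) : ℝ :=
  ∑ i ∈ Finset.range b,
    (Matrix.toEuclideanLin (Matrix.of fun (r : Fin a) (c : Fin b) => A (r, c))).singularValues i

section Spaces

variable (l n : ℕ) (d : Fin (l + 2) → ℕ)

/-- The slack variables `h_q^{(i)}`, `q = 1..n`, `i = 1..l`; layer `0` is the input, so the
`i`-th hidden layer (`i : Fin l`, counted from `0`) has width `d i.castSucc.succ`. -/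
abbrev HSpace : Type :=
  PiLp 2 fun _ : Fin n => PiLp 2 fun i : Fin l => Vec (d i.castSucc.succ)

/-- One matrix of size `d_{j+1} × d_j` for each of the `l + 1` layers. -/
abbrev VSpace : Type :=
  PiLp 2 fun j : Fin (l + 1) => Mat (d j.succ) (d j.castSucc)

/-- The parameter vector `θ = (W, b)`, with its Euclidean norm. -/
abbrev ThetaSpace : Type :=
  WithLp 2 (VSpace l d × PiLp 2 fun j : Fin (l + 1) => Vec (d j.succ))

/-- All variables `(h, V, θ)`. -/
abbrev State : Type :=
  WithLp 2 (HSpace l n d × WithLp 2 (VSpace l d × ThetaSpace l d))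

end Spaces

section Model

variable {l n : ℕ} {d : Fin (l + 2) → ℕ}

/-- The block `h_q^{(i)}` of a state. -/
def State.h (x : State l n d) (q : Fin n) (i : Fin l) : Vec (d i.castSucc.succ) := x.fst q i

/-- The block `V^{(j)}` of a state. -/
def State.V (x : State l n d) (j : Fin (l + 1)) : Mat (d j.succ) (d j.castSucc) := x.snd.fst j

/-- The block `θ` of a state. -/
def State.θ (x : State l n d) : ThetaSpace l d := x.snd.snd

/-- The data of the nonlinear matrix completion model: a fully connected network with `l` hidden
layers of widths `d`, as many output as input neurons, and twice continuously differentiable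
activation maps (a scalar activation function acts entrywise); the data matrix `X`, whose `n`
columns are the inputs, with the set `Ω` of observed entries; and the weights. -/
structure Model (l n : ℕ) (d : Fin (l + 2) → ℕ) where
  hio : d (Fin.last (l + 1)) = d 0
  X : Matrix (Fin (d 0)) (Fin n) ℝ
  Ω : Finset (Fin (d 0) × Fin n)
  act : ∀ j : Fin (l + 1), Vec (d j.succ) → Vec (d j.succ)
  act_contDiff : ∀ j, ContDiff ℝ 2 (act j)
  lam : ℝ
  lam_pos : 0 < lam
  α : Fin l → ℝ
  α_nonneg : ∀ i, 0 ≤ α i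
  β : Fin (l + 1) → ℝ
  β_nonneg : ∀ j, 0 ≤ β j
  μh : Fin l → ℝ
  μh_pos : ∀ i, 0 < μh i
  μv : Fin (l + 1) → ℝ
  μv_pos : ∀ j, 0 < μv j
  M : ℝ
  M_pos : 0 < M

namespace Model

variable (P : Model l n d)

/-- The `q`-th column of `X`. -/
def input (q : Fin n) : Vec (d 0) := WithLp.toLp 2 fun r => P.X r q

/-- Output of layer `i` of the network on input `x` (layer `0` is the input itself):
`z^{(j+1)} = act_j (W_j z^{(j)} + b_j)`. -/
def layer (θ : ThetaSpace l d) (x : Vec (d 0)) (i : Fin (l + 2)) : Vec (d i) :=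
  Fin.induction (motive := fun i => Vec (d i)) x
    (fun j z => P.act j (WithLp.toLp 2 fun r => (∑ c, θ.fst j (r, c) * z c) + θ.snd j r)) i

/-- Output `z_q^{(i)}` of the `i`-th hidden layer on the `q`-th column. -/
def z (θ : ThetaSpace l d) (q : Fin n) (i : Fin l) : Vec (d i.castSucc.succ) :=
  P.layer θ (P.input q) i.castSucc.succ

/-- The entry of the network output `X̂` in row `r`, column `q`. -/
def xhat (θ : ThetaSpace l d) (r : Fin (d 0)) (q : Fin n) : ℝ :=
  P.layer θ (P.input q) (Fin.last (l + 1)) (Fin.cast P.hio.symm r)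

/-- `‖N ⊙ (X - X̂)‖_F² + λ ∑_j ‖W^{(j)}‖_F²`, with `N` the 0-1 mask of `Ω`. -/
def loss (θ : ThetaSpace l d) : ℝ :=
  (∑ p ∈ P.Ω, (P.X p.1 p.2 - P.xhat θ p.1 p.2) ^ 2) + P.lam * ∑ j, ‖θ.fst j‖ ^ 2

/-- The smooth part of the objective. -/
def g (h : ∀ (_ : Fin n) (i : Fin l), Vec (d i.castSucc.succ))
    (V : ∀ j : Fin (l + 1), Mat (d j.succ) (d j.castSucc)) (θ : ThetaSpace l d) : ℝ :=
  P.loss θ + (∑ q, ∑ i, 1 / (2 * P.μh i) * ‖P.z θ q i - h q i‖ ^ 2)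
    + ∑ j, 1 / (2 * P.μv j) * ‖θ.fst j - V j‖ ^ 2

/-- `r_h(y) = α_i ‖y‖₁` for the block of hidden layer `i`. -/
def rh (i : Fin l) (y : Vec (d i.castSucc.succ)) : ℝ := P.α i * ∑ a, |y a|

/-- `r_v(Y) = β_j ‖Y‖_*` for layer `j`. -/
def rv (j : Fin (l + 1)) (Y : Mat (d j.succ) (d j.castSucc)) : ℝ := P.β j * nuclearNorm Y

/-- The box `‖θ‖_∞ ≤ M`. -/
def box : Set (ThetaSpace l d) :=
  {θ | (∀ j e, |θ.fst j e| ≤ P.M) ∧ (∀ j a, |θ.snd j a| ≤ P.M)}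

open Classical in
/-- `r_θ`: zero if `‖θ‖_∞ ≤ M` and `+∞` otherwise. -/
def rθ (θ : ThetaSpace l d) : EReal := if θ ∈ P.box then 0 else ⊤

/-- The objective `Q = g + ∑ r_h + ∑ r_v + r_θ`. -/
def Q (x : State l n d) : EReal :=
  ((P.g x.h x.V x.θ + (∑ q, ∑ i, P.rh i (x.h q i)) + ∑ j, P.rv j (x.V j) : ℝ) : EReal)
    + P.rθ x.θ

end Model

/-! ### The algorithm -/

/-- Blocks `h`: those before `(q, i)` (lexicographically) from `new`, block `(q, i)` equal to `y`,
those after it from `old`. -/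
def mixH (new old : ∀ (_ : Fin n) (i : Fin l), Vec (d i.castSucc.succ)) (q : Fin n) (i : Fin l)
    (y : Vec (d i.castSucc.succ)) : ∀ (_ : Fin n) (i : Fin l), Vec (d i.castSucc.succ) :=
  let m : ∀ (_ : Fin n) (i : Fin l), Vec (d i.castSucc.succ) :=
    fun q' i' => if q' < q ∨ (q' = q ∧ i' < i) then new q' i' else old q' i'
  Function.update m q (Function.update (m q) i y)

/-- Blocks `V`: those before `j` from `new`, block `j` equal to `Y`, those after it from `old`. -/
def mixV (new old : ∀ j : Fin (l + 1), Mat (d j.succ) (d j.castSucc)) (j : Fin (l + 1))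
    (Y : Mat (d j.succ) (d j.castSucc)) : ∀ j : Fin (l + 1), Mat (d j.succ) (d j.castSucc) :=
  Function.update (fun j' => if j' < j then new j' else old j') j Y

/-- Step sizes and extrapolation weights, indexed by the epoch `k`.
`sh k i`, `sv k j` are the step sizes of the `h^{(i)}`- and `V^{(j)}`-updates; they lie between a
positive lower bound and the reciprocal (`μh i`, `μv j`) of the Lipschitz constant of the respective
partial gradient of `g`. The step size of the `θ`-update is `1 / (γ L k)`. -/
structure StepRule (P : Model l n d) where
  γ : ℝ
  one_lt_γ : 1 < γ
  shMin : Fin l → ℝ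
  shMin_pos : ∀ i, 0 < shMin i
  sh : ℕ → Fin l → ℝ
  sh_mem : ∀ k i, sh k i ∈ Set.Icc (shMin i) (P.μh i)
  svMin : Fin (l + 1) → ℝ
  svMin_pos : ∀ j, 0 < svMin j
  sv : ℕ → Fin (l + 1) → ℝ
  sv_mem : ∀ k j, sv k j ∈ Set.Icc (svMin j) (P.μv j)
  μθMin : ℝ
  μθMin_pos : 0 < μθMin
  μθMax : ℝ
  L : ℕ → ℝ
  L_pos : ∀ k, 0 < L k
  μθ_mem : ∀ k, 1 / (γ * L k) ∈ Set.Icc μθMin μθMax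
  δ : ℕ → ℝ
  δmax : ℝ
  δmax_lt_one : δmax < 1
  δ_mem : ∀ k, δ k ∈ Set.Icc 0 δmax
  ω : ℕ → ℝ
  ω_nonneg : ∀ k, 0 ≤ ω k
  ω_le : ∀ k, ω (k + 1) ≤ (γ - 1) / (2 * (γ + 1)) * √(δ (k + 1) * (L k / L (k + 1)))

namespace StepRule

variable {P : Model l n d} (S : StepRule P)

/-- The step size `μ_{θ,k} = 1 / (γ L_{θ,k})`. -/
def μθ (k : ℕ) : ℝ := 1 / (S.γ * S.L k)

/-- The extrapolated point `θ̂_k = θ_k + ω_{k+1} (θ_k - θ_{k-1})`; since `0 - 1 = 0` in `ℕ`, the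
convention `θ_{-1} = θ_0` is built in. -/
def hat (ξ : ℕ → State l n d) (k : ℕ) : ThetaSpace l d :=
  (ξ k).θ + S.ω (k + 1) • ((ξ k).θ - (ξ (k - 1)).θ)

/-- `∇_θ g(h_{k+1}, V_{k+1}, ·)`. -/
def gradθ (P : Model l n d) (ξ : ℕ → State l n d) (k : ℕ) (t : ThetaSpace l d) :
    ThetaSpace l d :=
  gradient (fun u => P.g (ξ (k + 1)).h (ξ (k + 1)).V u) t

/-- `ξ k = (h_k, V_k, θ_k)` is generated by the extrapolated alternating proximal gradient method:
epoch `k + 1` updates the blocks `h_q^{(i)}` in lexicographic order of `(q, i)`, then the `V^{(j)}`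
in order, then `θ`. The number `L (k + 1)` is a Lipschitz constant of `∇_θ g(h_{k+1}, V_{k+1}, ·)`
on the box `‖θ‖_∞ ≤ M` together with the extrapolated point. -/
structure IsGenerated (ξ : ℕ → State l n d) : Prop where
  h_step : ∀ k q i, IsProx (fun y => (P.rh i y : EReal)) (S.sh (k + 1) i)
    ((ξ k).h q i - S.sh (k + 1) i •
      gradient (fun y => P.g (mixH (ξ (k + 1)).h (ξ k).h q i y) (ξ k).V (ξ k).θ) ((ξ k).h q i))
    ((ξ (k + 1)).h q i)
  V_step : ∀ k j, IsProx (fun Y => (P.rv j Y : EReal)) (S.sv (k + 1) j)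
    ((ξ k).V j - S.sv (k + 1) j •
      gradient (fun Y => P.g (ξ (k + 1)).h (mixV (ξ (k + 1)).V (ξ k).V j Y) (ξ k).θ) ((ξ k).V j))
    ((ξ (k + 1)).V j)
  lipschitz : ∀ k, ∀ t ∈ insert (S.hat ξ k) P.box, ∀ u ∈ insert (S.hat ξ k) P.box,
    ‖gradθ P ξ k t - gradθ P ξ k u‖ ≤ S.L (k + 1) * ‖t - u‖
  θ_step : ∀ k, IsProx P.rθ (S.μθ (k + 1))
    (S.hat ξ k - S.μθ (k + 1) • gradθ P ξ k (S.hat ξ k)) ((ξ (k + 1)).θ)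

end StepRule

end Model

end DNNNSR

end

/-! Adding to the objective `γ - 1` times a quarter of `L_{θ,k} ‖θ_k - θ_{k-1}‖²` gives a Lyapunov
function: the convex `h`- and `V`-updates decrease it by weighted squared increments because their
steps are at most `1/Lipschitz`, and by Young's inequality the bound on the extrapolation weights
leaves at least a fraction `1 - δmax` of the inertial term. Being nonnegative, it forces all
increments, and hence the extrapolation error, to zero, so the optimality conditions of the proximal
steps pass to the limit along any convergent subsequence. Together they say that `-∇g` is a
subgradient of the nonsmooth part, i.e. that the limit is critical. Convexity of the nuclear norm
comes from its representation as the supremum of the trace pairings with contractions. -/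

noncomputable section

namespace DNNNSR

section NuclearNorm

variable {E F : Type*} [NormedAddCommGroup E] [InnerProductSpace ℝ E]
  [NormedAddCommGroup F] [InnerProductSpace ℝ F]

-- Bessel's inequality without normalization: the vectors may vanish.
theorem sum_inner_sq_le_norm_sq {ι : Type*} [Fintype ι] {u : ι → F}
    (hu : Pairwise fun i j => inner ℝ (u i) (u j) = 0) (hu₁ : ∀ i, ‖u i‖ ≤ 1) (y : F) :
    ∑ i, inner ℝ (u i) y ^ 2 ≤ ‖y‖ ^ 2 := by
  set p := ∑ i, inner ℝ (u i) y • u i with hp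
  have inner_p_y : inner ℝ p y = ∑ i, inner ℝ (u i) y ^ 2 := by
    simp only [hp, sum_inner, inner_smul_left, RCLike.conj_to_real, sq]
  have inner_u_p (i : ι) : inner ℝ (u i) p = inner ℝ (u i) y * ‖u i‖ ^ 2 := by
    simp only [hp, inner_sum, inner_smul_right]
    rw [Finset.sum_eq_single i (fun j _ hj => by rw [hu hj.symm, mul_zero]) (by simp),
      real_inner_self_eq_norm_sq]
  have norm_p : ‖p‖ ^ 2 ≤ ∑ i, inner ℝ (u i) y ^ 2 := by
    rw [← real_inner_self_eq_norm_sq]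
    nth_rewrite 1 [hp]
    simp only [sum_inner, inner_smul_left, RCLike.conj_to_real, inner_u_p]
    refine Finset.sum_le_sum fun i _ => ?_
    rw [← mul_assoc, ← sq]
    exact mul_le_of_le_one_right (sq_nonneg _) (pow_le_one₀ (norm_nonneg _) (hu₁ i))
  have := norm_sub_sq_real y p
  rw [real_inner_comm] at this
  linarith [sq_nonneg ‖y - p‖]

variable [FiniteDimensional ℝ E] [FiniteDimensional ℝ F] (T : E →ₗ[ℝ] F)

theorem inner_apply_eigenvectorBasis {N : ℕ} (hN : Module.finrank ℝ E = N) (i j : Fin N) :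
    inner ℝ (T (T.isSymmetric_adjoint_comp_self.eigenvectorBasis hN i))
      (T (T.isSymmetric_adjoint_comp_self.eigenvectorBasis hN j)) =
      if i = j then T.singularValues i ^ 2 else 0 := by
  rw [← LinearMap.adjoint_inner_left, ← LinearMap.comp_apply,
    T.isSymmetric_adjoint_comp_self.apply_eigenvectorBasis hN i, inner_smul_left,
    T.sq_singularValues_fin hN, OrthonormalBasis.inner_eq_ite]
  split_ifs <;> simp

theorem norm_apply_eigenvectorBasis {N : ℕ} (hN : Module.finrank ℝ E = N) (i : Fin N) :
    ‖T (T.isSymmetric_adjoint_comp_self.eigenvectorBasis hN i)‖ = T.singularValues i := by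
  have h := inner_apply_eigenvectorBasis T hN i i
  rw [real_inner_self_eq_norm_sq, if_pos rfl] at h
  exact (sq_eq_sq₀ (norm_nonneg _) (T.singularValues_nonneg i)).1 h

theorem trace_comp_le_sum_singularValues {C : F →ₗ[ℝ] E} (hC : ∀ y, ‖C y‖ ≤ ‖y‖) :
    LinearMap.trace ℝ E (C ∘ₗ T) ≤
      ∑ i ∈ Finset.range (Module.finrank ℝ E), T.singularValues i := by
  rw [LinearMap.trace_eq_sum_inner _ (T.isSymmetric_adjoint_comp_self.eigenvectorBasis rfl),
    Finset.sum_range]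
  refine Finset.sum_le_sum fun i _ => (real_inner_le_norm _ _).trans ?_
  rw [OrthonormalBasis.norm_eq_one, one_mul, LinearMap.comp_apply]
  exact (hC _).trans_eq (norm_apply_eigenvectorBasis T rfl i)

/-- The left singular vectors of `T`, indexed like its right singular vectors, which are the
eigenvectors of `T* T`; since `0⁻¹ = 0`, the vector is `0` where the singular value vanishes. -/
def leftSingularVector (i : Fin (Module.finrank ℝ E)) : F :=
  (T.singularValues i)⁻¹ • T (T.isSymmetric_adjoint_comp_self.eigenvectorBasis rfl i)

theorem inner_leftSingularVector_apply (i j : Fin (Module.finrank ℝ E)) :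
    inner ℝ (leftSingularVector T i)
      (T (T.isSymmetric_adjoint_comp_self.eigenvectorBasis rfl j)) =
      if i = j then T.singularValues i else 0 := by
  rw [leftSingularVector, inner_smul_left, inner_apply_eigenvectorBasis, mul_ite, mul_zero,
    RCLike.conj_to_real, sq, ← mul_assoc, inv_mul_mul_self]

theorem inner_leftSingularVector_of_ne {i j : Fin (Module.finrank ℝ E)} (hij : i ≠ j) :
    inner ℝ (leftSingularVector T i) (leftSingularVector T j) = 0 := by
  rw [leftSingularVector.eq_def T j, inner_smul_right, inner_leftSingularVector_apply,
    if_neg hij, mul_zero]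

theorem norm_leftSingularVector_le_one (i : Fin (Module.finrank ℝ E)) :
    ‖leftSingularVector T i‖ ≤ 1 := by
  rw [leftSingularVector, norm_smul, norm_apply_eigenvectorBasis, norm_inv,
    Real.norm_of_nonneg (T.singularValues_nonneg i)]
  exact inv_mul_le_one

theorem exists_trace_comp_eq_sum_singularValues :
    ∃ C : F →ₗ[ℝ] E, (∀ y, ‖C y‖ ≤ ‖y‖) ∧ LinearMap.trace ℝ E (C ∘ₗ T) =
      ∑ i ∈ Finset.range (Module.finrank ℝ E), T.singularValues i := by
  set v := T.isSymmetric_adjoint_comp_self.eigenvectorBasis rfl with hv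
  set C : F →ₗ[ℝ] E := ∑ i, (innerₛₗ ℝ (leftSingularVector T i)).smulRight (v i) with hC
  have inner_v_C (j) (y : F) : inner ℝ (v j) (C y) = inner ℝ (leftSingularVector T j) y := by
    simp only [hC, LinearMap.sum_apply, LinearMap.smulRight_apply, innerₛₗ_apply_apply, inner_sum,
      inner_smul_right, OrthonormalBasis.inner_eq_ite, mul_ite, mul_one, mul_zero,
      Finset.sum_ite_eq, Finset.mem_univ, if_true]
  refine ⟨C, fun y => le_of_sq_le_sq ?_ (norm_nonneg _), ?_⟩
  · rw [← v.sum_sq_norm_inner_right (C y)]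
    simp only [inner_v_C, Real.norm_eq_abs, sq_abs]
    exact sum_inner_sq_le_norm_sq (fun _ _ => inner_leftSingularVector_of_ne T)
      (norm_leftSingularVector_le_one T) y
  · rw [LinearMap.trace_eq_sum_inner _ v, Finset.sum_range]
    refine Finset.sum_congr rfl fun i _ => ?_
    rw [LinearMap.comp_apply, inner_v_C, hv, inner_leftSingularVector_apply, if_pos rfl]

-- By the two preceding lemmas the sum is a supremum of linear functions, `T ↦ trace (C ∘ T)`.
theorem convexOn_sum_singularValues :
    ConvexOn ℝ Set.univ fun T : E →ₗ[ℝ] F =>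
      ∑ i ∈ Finset.range (Module.finrank ℝ E), T.singularValues i := by
  refine ⟨convex_univ, fun A _ B _ a b ha hb _ => ?_⟩
  obtain ⟨C, hC, hAB⟩ := exists_trace_comp_eq_sum_singularValues (a • A + b • B)
  dsimp only
  rw [← hAB, LinearMap.comp_add, LinearMap.comp_smul, LinearMap.comp_smul, map_add, map_smul,
    map_smul]
  gcongr
  exacts [trace_comp_le_sum_singularValues A hC, trace_comp_le_sum_singularValues B hC]

theorem convexOn_nuclearNorm {a b : ℕ} : ConvexOn ℝ Set.univ (nuclearNorm (a := a) (b := b)) := by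
  let Φ : Mat a b →ₗ[ℝ] (EuclideanSpace ℝ (Fin b) →ₗ[ℝ] EuclideanSpace ℝ (Fin a)) :=
    { toFun := fun A => Matrix.toEuclideanLin (Matrix.of fun r c => A (r, c))
      map_add' := fun A B => by rw [← map_add]; rfl
      map_smul' := fun t A => by rw [RingHom.id_apply, ← map_smul]; rfl }
  have h := (convexOn_sum_singularValues (E := EuclideanSpace ℝ (Fin b))
    (F := EuclideanSpace ℝ (Fin a))).comp_linearMap Φ
  rwa [Set.preimage_univ, finrank_euclideanSpace_fin] at h

theorem continuous_nuclearNorm {a b : ℕ} : Continuous (nuclearNorm (a := a) (b := b)) :=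
  convexOn_nuclearNorm.locallyLipschitz.continuous

theorem nuclearNorm_nonneg {a b : ℕ} (A : Mat a b) : 0 ≤ nuclearNorm A :=
  Finset.sum_nonneg fun i _ => LinearMap.singularValues_nonneg _ i

end NuclearNorm

section Variational

variable {E : Type*} [NormedAddCommGroup E] [InnerProductSpace ℝ E]

theorem norm_sq_sub_div_segment {σ : ℝ} (x y u : E) (t : ℝ) :
    ‖(1 - t) • y + t • u - x‖ ^ 2 / (2 * σ) = ‖y - x‖ ^ 2 / (2 * σ)
      - t * (inner ℝ (x - y) (u - y) / σ - t * (‖u - y‖ ^ 2 / (2 * σ))) := by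
  have h : (1 - t) • y + t • u - x = t • (u - y) - (x - y) := by module
  rw [h, norm_sub_sq_real, inner_smul_left, norm_smul, RCLike.conj_to_real,
    real_inner_comm, norm_sub_rev x y, mul_pow, Real.norm_eq_abs, sq_abs]
  ring

theorem IsProx.variational_inequality {s : Set E} {r : E → ℝ} (hr : ConvexOn ℝ s r)
    {ρ : E → EReal} (hρ : ∀ u ∈ s, ρ u = r u) {σ : ℝ} {x y u : E} (h : IsProx ρ σ x y)
    (hy : y ∈ s) (hu : u ∈ s) : r y + inner ℝ (x - y) (u - y) / σ ≤ r u := by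
  -- Compare `y` with the point at parameter `t` of the segment from `y` to `u`; then let `t → 0`.
  have segment_le : ∀ t ∈ Set.Ioo (0 : ℝ) 1,
      r y + inner ℝ (x - y) (u - y) / σ ≤ r u + t * (‖u - y‖ ^ 2 / (2 * σ)) := by
    rintro t ⟨ht₀, ht₁⟩
    have ht : 0 ≤ 1 - t := by linarith
    have hmem : (1 - t) • y + t • u ∈ s := hr.1 hy hu ht ht₀.le (by ring)
    have hmin := h ((1 - t) • y + t • u)
    rw [hρ _ hy, hρ _ hmem, norm_sq_sub_div_segment] at hmin
    norm_cast at hmin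
    have hconv := hr.2 hy hu ht ht₀.le (by ring)
    simp only [smul_eq_mul] at hconv
    refine le_of_mul_le_mul_left ?_ ht₀
    linarith
  have hlim : Tendsto (fun t : ℝ => r u + t * (‖u - y‖ ^ 2 / (2 * σ))) (𝓝[>] 0) (𝓝 (r u)) :=
    tendsto_nhdsWithin_of_tendsto_nhds <| Continuous.tendsto' (by fun_prop) _ _ (by ring)
  refine ge_of_tendsto hlim ?_
  filter_upwards [Ioo_mem_nhdsGT (zero_lt_one' ℝ)] using segment_le

theorem tendsto_prox_inequality {ι : Type*} {l : Filter ι} [l.NeBot] {r : E → ℝ} {σ : ι → ℝ}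
    {a b G : ι → E} {a₀ G₀ u : E} {σ₀ : ℝ} (hr : ContinuousAt r a₀) (hσ₀ : 0 < σ₀)
    (hσ : ∀ k, σ₀ ≤ σ k) (ha : Tendsto a l (𝓝 a₀)) (hab : Tendsto (fun k => a k - b k) l (𝓝 0))
    (hG : Tendsto G l (𝓝 G₀))
    (h : ∀ k, r (b k) + inner ℝ (a k - σ k • G k - b k) (u - b k) / σ k ≤ r u) :
    r a₀ + inner ℝ (-G₀) (u - a₀) ≤ r u := by
  have hb : Tendsto b l (𝓝 a₀) := by simpa using ha.sub hab
  have hσab : Tendsto (fun k => (σ k)⁻¹ • (a k - b k)) l (𝓝 0) := by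
    refine squeeze_zero_norm (fun k => ?_) (by simpa using hab.norm.const_mul σ₀⁻¹)
    have := hσ₀.trans_le (hσ k)
    rw [norm_smul, norm_inv, Real.norm_of_nonneg this.le]
    gcongr
    exact hσ k
  have hlim : Tendsto (fun k => r (b k) + inner ℝ ((σ k)⁻¹ • (a k - b k) - G k) (u - b k)) l
      (𝓝 (r a₀ + inner ℝ (-G₀) (u - a₀))) := by
    rw [← zero_sub]
    exact (hr.tendsto.comp hb).add ((hσab.sub hG).inner (hb.const_sub u))
  refine le_of_tendsto hlim (.of_forall fun k => le_of_eq_of_le ?_ (h k))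
  have hσk : σ k ≠ 0 := (hσ₀.trans_le (hσ k)).ne'
  rw [div_eq_inv_mul, ← real_inner_smul_left, sub_right_comm,
    smul_sub _ (a k - b k), inv_smul_smul₀ hσk]

theorem prox_gradient_step_le {f r : E → ℝ} {σ L : ℝ} (hσ : σ ≠ 0) {x t y G₀ G : E}
    (hf : f y ≤ f x + inner ℝ G₀ (y - x) + L / 2 * ‖y - x‖ ^ 2)
    (hr : r y + inner ℝ (t - σ • G - y) (x - y) / σ ≤ r x) :
    f y + r y + (1 / σ - L / 2) * ‖y - x‖ ^ 2
      ≤ f x + r x + inner ℝ (G₀ - G) (y - x) + inner ℝ (t - x) (y - x) / σ := by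
  have h : inner ℝ (t - σ • G - y) (x - y) / σ
      = ‖y - x‖ ^ 2 / σ + inner ℝ G (y - x) - inner ℝ (t - x) (y - x) / σ := by
    have h₁ : t - σ • G - y = (t - x) - (y - x) - σ • G := by module
    rw [h₁, ← neg_sub y x, inner_neg_right, inner_sub_left, inner_sub_left, inner_smul_left,
      real_inner_self_eq_norm_sq, RCLike.conj_to_real]
    field_simp
    ring
  rw [h] at hr
  rw [inner_sub_left]
  linear_combination hf + hr

theorem quadratic_prox_gradient_step_le {r : E → ℝ} {σ μ : ℝ} (hσ : 0 < σ) (hσμ : σ ≤ μ)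
    {z x y : E} (hr : r y + inner ℝ (x - σ • (μ⁻¹ • (x - z)) - y) (x - y) / σ ≤ r x) :
    1 / (2 * μ) * ‖z - y‖ ^ 2 + r y + 1 / (2 * μ) * ‖y - x‖ ^ 2
      ≤ 1 / (2 * μ) * ‖z - x‖ ^ 2 + r x := by
  have hμ : 0 < μ := hσ.trans_le hσμ
  have taylor : 1 / (2 * μ) * ‖z - y‖ ^ 2 = 1 / (2 * μ) * ‖z - x‖ ^ 2
      + inner ℝ (μ⁻¹ • (x - z)) (y - x) + 1 / μ / 2 * ‖y - x‖ ^ 2 := by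
    have h : z - y = (z - x) - (y - x) := by abel
    rw [h, norm_sub_sq_real, inner_smul_left, RCLike.conj_to_real, ← neg_sub z x, inner_neg_left]
    field_simp
    ring
  have step := prox_gradient_step_le (f := fun y => 1 / (2 * μ) * ‖z - y‖ ^ 2) hσ.ne' taylor.le hr
  simp only [sub_self, inner_zero_left, zero_div, add_zero] at step
  have hle : 1 / (2 * μ) * ‖y - x‖ ^ 2 ≤ (1 / σ - 1 / μ / 2) * ‖y - x‖ ^ 2 := by
    have h₁ : 1 / μ ≤ 1 / σ := one_div_le_one_div_of_le hσ hσμ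
    have h₂ : 1 / (2 * μ) = 1 / μ - 1 / μ / 2 := by ring
    rw [h₂]
    gcongr
  linarith

end Variational

section Gradient

variable {E : Type*} [NormedAddCommGroup E] [InnerProductSpace ℝ E] [CompleteSpace E]

theorem hasGradientAt_quadratic (μ : ℝ) (z y : E) :
    HasGradientAt (fun y => 1 / (2 * μ) * ‖z - y‖ ^ 2) (μ⁻¹ • (y - z)) y := by
  rw [hasGradientAt_iff_hasFDerivAt]
  refine ((((hasFDerivAt_id y).const_sub z).norm_sq).const_mul (1 / (2 * μ))).congr_fderiv ?_
  ext v
  simp only [id_eq, ContinuousLinearMap.comp_neg, ContinuousLinearMap.comp_id, smul_neg,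
    neg_apply, smul_apply, innerSL_apply_apply,
    smul_eq_mul, nsmul_eq_mul, InnerProductSpace.toDual_apply_apply, inner_smul_left,
    RCLike.conj_to_real, ← neg_sub z y, inner_neg_left]
  ring

variable {s : Set E} {f : E → ℝ} {G : E → E} {L : ℝ} {x y : E}

theorem descent_of_lipschitz_gradient (hs : Convex ℝ s) (hf : ∀ x ∈ s, HasGradientAt f (G x) x)
    (hL : ∀ x ∈ s, ∀ y ∈ s, ‖G x - G y‖ ≤ L * ‖x - y‖) (hx : x ∈ s) (hy : y ∈ s) :
    f y ≤ f x + inner ℝ (G x) (y - x) + L / 2 * ‖y - x‖ ^ 2 := by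
  set p : ℝ →ᵃ[ℝ] E := AffineMap.lineMap x y with hp
  have hp_mem : ∀ t ∈ Set.Icc (0 : ℝ) 1, p t ∈ s := fun t ht => hs.lineMap_mem hx hy ht
  have hf' : ∀ t ∈ Set.Icc (0 : ℝ) 1,
      HasDerivAt (fun t => f (p t)) (inner ℝ (G (p t)) (y - x)) t := fun t ht =>
    ((hf _ (hp_mem t ht)).hasFDerivAt.comp_hasDerivAt t AffineMap.hasDerivAt_lineMap).congr_deriv
      (InnerProductSpace.toDual_apply_apply ..)
  have hB' (t : ℝ) : HasDerivAt
      (fun t => f x + t * inner ℝ (G x) (y - x) + t ^ 2 * (L / 2 * ‖y - x‖ ^ 2))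
      (inner ℝ (G x) (y - x) + t * (L * ‖y - x‖ ^ 2)) t := by
    refine ((((hasDerivAt_id t).mul_const (inner ℝ (G x) (y - x))).const_add (f x)).add
      ((hasDerivAt_pow 2 t).mul_const (L / 2 * ‖y - x‖ ^ 2))).congr_deriv ?_
    push_cast
    ring
  have deriv_le : ∀ t ∈ Set.Icc (0 : ℝ) 1, inner ℝ (G (p t)) (y - x)
      ≤ inner ℝ (G x) (y - x) + t * (L * ‖y - x‖ ^ 2) := fun t ht => by
    have hG := hL _ (hp_mem t ht) _ hx
    rw [hp, AffineMap.lineMap_apply_module', add_sub_cancel_right, norm_smul,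
      Real.norm_of_nonneg ht.1] at hG
    have := (real_inner_le_norm (G (p t) - G x) (y - x)).trans
      (mul_le_mul_of_nonneg_right hG (norm_nonneg _))
    rw [inner_sub_left] at this
    linarith
  have := image_le_of_deriv_right_le_deriv_boundary
    (fun t ht => (hf' t ht).continuousAt.continuousWithinAt)
    (fun t ht => (hf' t (Set.Ico_subset_Icc_self ht)).hasDerivWithinAt) (by simp [hp])
    (fun t _ => (hB' t).continuousAt.continuousWithinAt)
    (fun t _ => (hB' t).hasDerivWithinAt)
    (fun t ht => deriv_le t (Set.Ico_subset_Icc_self ht)) (Set.right_mem_Icc.2 zero_le_one)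
  simpa [hp] using this

theorem extrapolated_projected_gradient_step_le (hs : Convex ℝ s)
    (hf : ∀ x ∈ s, HasGradientAt f (G x) x) {γ : ℝ} (hL₀ : 0 < L) (hγ : 1 < γ) {t : E}
    (hL : ∀ x ∈ insert t s, ∀ y ∈ insert t s, ‖G x - G y‖ ≤ L * ‖x - y‖) (hx : x ∈ s) (hy : y ∈ s)
    (h : inner ℝ (t - (1 / (γ * L)) • G t - y) (x - y) / (1 / (γ * L)) ≤ 0) :
    f y + (γ - 1) / 4 * L * ‖y - x‖ ^ 2
      ≤ f x + (γ + 1) ^ 2 / (γ - 1) * (L * ‖t - x‖ ^ 2) := by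
  have step := prox_gradient_step_le (r := 0) (σ := 1 / (γ * L)) (by positivity)
    (descent_of_lipschitz_gradient hs hf (fun x hx y hy => hL x (.inr hx) y (.inr hy)) hx hy)
    (by simpa using h)
  have gradient_error : inner ℝ (G x - G t) (y - x) ≤ L * ‖t - x‖ * ‖y - x‖ := by
    have := hL x (.inr hx) t (.inl rfl)
    rw [norm_sub_rev x t] at this
    exact (real_inner_le_norm _ _).trans (mul_le_mul_of_nonneg_right this (norm_nonneg _))
  have inertia_error : inner ℝ (t - x) (y - x) / (1 / (γ * L)) ≤ γ * L * (‖t - x‖ * ‖y - x‖) := by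
    rw [div_div_eq_mul_div, div_one, mul_comm]
    exact mul_le_mul_of_nonneg_left (real_inner_le_norm _ _) (by positivity)
  have young : (γ + 1) * (‖t - x‖ * ‖y - x‖)
      ≤ (γ - 1) / 4 * ‖y - x‖ ^ 2 + (γ + 1) ^ 2 / (γ - 1) * ‖t - x‖ ^ 2 := by
    have hγ' : 0 < γ - 1 := sub_pos.2 hγ
    have : 0 ≤ ((γ - 1) / 2 * ‖y - x‖ - (γ + 1) * ‖t - x‖) ^ 2 / (γ - 1) := by positivity
    convert sub_nonneg.1 (this.trans_eq _) using 1
    field_simp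
    ring
  simp only [Pi.zero_apply, add_zero, one_div_one_div] at step
  have hLD : 0 ≤ γ * (L * ‖y - x‖ ^ 2) := by positivity
  linear_combination step + gradient_error + inertia_error + L * young + hLD / 2

end Gradient

section Subdifferential

variable {E : Type*} [NormedAddCommGroup E] [InnerProductSpace ℝ E] {f : E → EReal} {x v : E}

theorem mem_frechetSubdiff_of_forall_le (htop : f x ≠ ⊤) (hbot : f x ≠ ⊥)
    (h : ∀ y, f x + ((inner ℝ v (y - x) : ℝ) : EReal) ≤ f y) : v ∈ frechetSubdiff f x := by
  refine ⟨htop, hbot, fun ε hε => .of_forall fun y => le_trans ?_ (h y)⟩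
  gcongr
  exact sub_le_self _ (by positivity)

theorem frechetSubdiff_subset_limitingSubdiff : frechetSubdiff f x ⊆ limitingSubdiff f x :=
  fun v hv => ⟨hv.1, hv.2.1, fun _ => x, fun _ => v, tendsto_const_nhds, tendsto_const_nhds,
    fun _ => hv, tendsto_const_nhds⟩

theorem add_mem_frechetSubdiff [CompleteSpace E] {φ : E → ℝ} {w : E} (hφ : HasGradientAt φ w x)
    (hv : v ∈ frechetSubdiff f x) : w + v ∈ frechetSubdiff (fun y => (φ y : EReal) + f y) x := by
  obtain ⟨htop, hbot, hf⟩ := hv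
  refine ⟨EReal.add_ne_top (EReal.coe_ne_top _) htop,
    EReal.add_ne_bot_iff.2 ⟨EReal.coe_ne_bot _, hbot⟩, fun ε hε => ?_⟩
  filter_upwards [hf (ε / 2) (half_pos hε),
    (hasGradientAt_iff_isLittleO.1 hφ).bound (half_pos hε)] with y hfy hφy
  have hφy' : φ x + (inner ℝ w (y - x) - ε / 2 * ‖y - x‖) ≤ φ y := by
    linarith [(abs_le.1 hφy).1]
  calc _ = ((φ x + (inner ℝ w (y - x) - ε / 2 * ‖y - x‖) : ℝ) : EReal)
        + (f x + ((inner ℝ v (y - x) - ε / 2 * ‖y - x‖ : ℝ) : EReal)) := by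
        rw [EReal.coe_add, add_add_add_comm, ← EReal.coe_add, inner_add_left]
        ring_nf
    _ ≤ _ := add_le_add (EReal.coe_le_coe_iff.2 hφy') hfy

end Subdifferential

section PartialGradient

variable {E F : Type*} [NormedAddCommGroup E] [InnerProductSpace ℝ E] [CompleteSpace E]
  [NormedAddCommGroup F] [InnerProductSpace ℝ F] [CompleteSpace F]

theorem hasGradientAt_comp_of_inner_eq {f : E → ℝ} {s : F → E} {A : F →L[ℝ] E} {v : E} {w y : F}
    (hf : HasGradientAt f v (s y)) (hs : HasFDerivAt s A y)
    (hA : ∀ u, inner ℝ v (A u) = inner ℝ w u) : HasGradientAt (fun y => f (s y)) w y := by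
  refine hasGradientAt_iff_hasFDerivAt.2 ((hf.hasFDerivAt.comp y hs).congr_fderiv ?_)
  ext u
  simpa using hA u

variable {f : WithLp 2 (E × F) → ℝ} {x v : WithLp 2 (E × F)}

theorem hasGradientAt_toLp_fst (hf : HasGradientAt f v x) :
    HasGradientAt (fun y => f (WithLp.toLp 2 (y, x.snd))) v.fst x.fst :=
  hasGradientAt_comp_of_inner_eq (v := v) hf
    ((WithLp.prodContinuousLinearEquiv 2 ℝ E F).symm.hasFDerivAt.comp _
      (hasFDerivAt_prodMk_left x.fst x.snd)) fun u => by simp [WithLp.prod_inner_apply]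

theorem hasGradientAt_toLp_snd (hf : HasGradientAt f v x) :
    HasGradientAt (fun y => f (WithLp.toLp 2 (x.fst, y))) v.snd x.snd :=
  hasGradientAt_comp_of_inner_eq (v := v) hf
    ((WithLp.prodContinuousLinearEquiv 2 ℝ E F).symm.hasFDerivAt.comp _
      (hasFDerivAt_prodMk_right x.fst x.snd)) fun u => by simp [WithLp.prod_inner_apply]

variable {ι : Type*} [Fintype ι] [DecidableEq ι] {H : ι → Type*} [∀ i, NormedAddCommGroup (H i)]
  [∀ i, InnerProductSpace ℝ (H i)] [∀ i, CompleteSpace (H i)]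

theorem hasGradientAt_toLp_update {f : PiLp 2 H → ℝ} {x v : PiLp 2 H} (hf : HasGradientAt f v x)
    (i : ι) : HasGradientAt (fun y => f (WithLp.toLp 2 (Function.update x i y))) (v i) (x i) := by
  have hx : WithLp.toLp 2 (Function.update (⇑x) i (x i)) = x := by
    rw [Function.update_eq_self]
  refine hasGradientAt_comp_of_inner_eq (hx.symm ▸ hf)
    ((PiLp.hasFDerivAt_toLp 2 _).comp (x i) (hasFDerivAt_update (⇑x) (x i))) fun u => ?_
  rw [PiLp.inner_apply, Finset.sum_eq_single i (fun j _ hj => by simp [hj]) (by simp)]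
  simp

variable {X : Type*} [NormedAddCommGroup X] [InnerProductSpace ℝ X] [CompleteSpace X]

theorem hasGradientAt_const_add {f : X → ℝ} {w y : X} (hf : HasGradientAt f w y) (c : ℝ) :
    HasGradientAt (fun y => c + f y) w y :=
  hasGradientAt_iff_hasFDerivAt.2 (hf.hasFDerivAt.const_add c)

theorem hasGradientAt_add_const {f : X → ℝ} {w y : X} (hf : HasGradientAt f w y) (c : ℝ) :
    HasGradientAt (fun y => f y + c) w y :=
  hasGradientAt_iff_hasFDerivAt.2 (hf.hasFDerivAt.add_const c)

theorem hasGradientAt_sum_update {H : ι → Type*} {φ : ∀ i, H i → ℝ} {i : ι} {a : X → H i}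
    {w y : X} (hφ : HasGradientAt (fun y => φ i (a y)) w y) (m : ∀ i, H i) :
    HasGradientAt (fun y => ∑ j, φ j (Function.update m i (a y) j)) w y := by
  simp only [Function.apply_update φ, Finset.sum_update_of_mem (Finset.mem_univ i)]
  exact hasGradientAt_add_const hφ _

end PartialGradient

theorem penalty_nonneg {E : Type*} [NormedAddCommGroup E] {μ : ℝ} (hμ : 0 < μ) (v : E) :
    0 ≤ 1 / (2 * μ) * ‖v‖ ^ 2 := by
  positivity

section WithLpSmooth

variable {X E F : Type*} [NormedAddCommGroup X] [NormedSpace ℝ X] [NormedAddCommGroup E]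
  [NormedSpace ℝ E] [NormedAddCommGroup F] [NormedSpace ℝ F] {m : WithTop ℕ∞}
  {f : X → WithLp 2 (E × F)}

@[fun_prop]
theorem contDiff_withLp_fst (hf : ContDiff ℝ m f) : ContDiff ℝ m fun x => (f x).fst :=
  (WithLp.contDiff_ofLp.comp hf).fst

@[fun_prop]
theorem contDiff_withLp_snd (hf : ContDiff ℝ m f) : ContDiff ℝ m fun x => (f x).snd :=
  (WithLp.contDiff_ofLp.comp hf).snd

end WithLpSmooth

section Model

variable {l n : ℕ} {d : Fin (l + 2) → ℕ}

namespace State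

@[fun_prop]
theorem continuous_h (q : Fin n) (i : Fin l) : Continuous fun x : State l n d => x.h q i := by
  unfold State.h
  fun_prop

@[fun_prop]
theorem continuous_V (j : Fin (l + 1)) : Continuous fun x : State l n d => x.V j := by
  unfold State.V
  fun_prop

@[fun_prop]
theorem continuous_θ : Continuous fun x : State l n d => x.θ := by
  unfold State.θ
  fun_prop

theorem tendsto_of_blocks {ι : Type*} {u : Filter ι} {η : ι → State l n d} {x : State l n d}
    (hh : ∀ q i, Tendsto (fun k => (η k).h q i) u (𝓝 (x.h q i)))
    (hV : ∀ j, Tendsto (fun k => (η k).V j) u (𝓝 (x.V j)))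
    (hθ : Tendsto (fun k => (η k).θ) u (𝓝 x.θ)) : Tendsto η u (𝓝 x) := by
  have hfst : Tendsto (fun k => (η k).fst) u (𝓝 x.fst) :=
    ((PiLp.continuous_toLp 2 _).tendsto _).comp <| tendsto_pi_nhds.2 fun q =>
      ((PiLp.continuous_toLp 2 _).tendsto _).comp (tendsto_pi_nhds.2 (hh q))
  have hsnd : Tendsto (fun k => (η k).snd.fst) u (𝓝 x.snd.fst) :=
    ((PiLp.continuous_toLp 2 _).tendsto _).comp (tendsto_pi_nhds.2 hV)
  exact ((WithLp.prod_continuous_toLp 2 _ _).tendsto _).comp (hfst.prodMk_nhds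
    (((WithLp.prod_continuous_toLp 2 _ _).tendsto _).comp (hsnd.prodMk_nhds hθ)))

/-- The state `x` with its block `θ` replaced by `t`. -/
def withθ (x : State l n d) (t : ThetaSpace l d) : State l n d :=
  WithLp.toLp 2 (x.fst, WithLp.toLp 2 (x.snd.fst, t))

theorem continuous_withθ :
    Continuous fun p : State l n d × ThetaSpace l d => p.1.withθ p.2 := by
  unfold withθ
  fun_prop

theorem inner_eq_sum_blocks (x y : State l n d) :
    inner ℝ x y = (∑ q, ∑ i, inner ℝ (x.h q i) (y.h q i)) + ∑ j, inner ℝ (x.V j) (y.V j)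
      + inner ℝ x.θ y.θ := by
  simp only [WithLp.prod_inner_apply, PiLp.inner_apply, ← add_assoc]
  rfl

end State

namespace Model

variable (P : Model l n d)

theorem layer_succ (θ : ThetaSpace l d) (x : Vec (d 0)) (j : Fin (l + 1)) :
    P.layer θ x j.succ = P.act j (WithLp.toLp 2 fun r =>
      (∑ c, θ.fst j (r, c) * P.layer θ x j.castSucc c) + θ.snd j r) :=
  rfl

theorem contDiff_layer (x : Vec (d 0)) (i : Fin (l + 2)) :
    ContDiff ℝ 2 fun θ : ThetaSpace l d => P.layer θ x i := by
  induction i using Fin.induction with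
  | zero => exact contDiff_const
  | succ j ih =>
    simp only [layer_succ]
    refine (P.act_contDiff j).comp (contDiff_euclidean.2 fun r => ?_)
    have := contDiff_euclidean.1 ih
    fun_prop

theorem contDiff_z (q : Fin n) (i : Fin l) : ContDiff ℝ 2 fun θ => P.z θ q i :=
  P.contDiff_layer _ _

theorem contDiff_loss : ContDiff ℝ 2 P.loss := by
  have (r : Fin (d 0)) (q : Fin n) : ContDiff ℝ 2 fun θ => P.xhat θ r q :=
    contDiff_euclidean.1 (P.contDiff_layer _ _) _
  have (j : Fin (l + 1)) : ContDiff ℝ 2 fun θ : ThetaSpace l d => ‖θ.fst j‖ ^ 2 :=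
    ContDiff.norm_sq ℝ (by fun_prop)
  unfold loss
  fun_prop

/-- The smooth part `g` of the objective as a function of the whole state, so that its gradient
collects all partial gradients. -/
def smoothPart (x : State l n d) : ℝ := P.g x.h x.V x.θ

theorem contDiff_smoothPart : ContDiff ℝ 2 P.smoothPart := by
  have hθ : ContDiff ℝ 2 fun x : State l n d => x.θ := by
    unfold State.θ
    fun_prop
  have hh (q : Fin n) (i : Fin l) :
      ContDiff ℝ 2 fun x : State l n d => ‖P.z x.θ q i - x.h q i‖ ^ 2 :=
    (((P.contDiff_z q i).comp hθ).sub (by unfold State.h; fun_prop)).norm_sq ℝ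
  have hV (j : Fin (l + 1)) : ContDiff ℝ 2 fun x : State l n d => ‖x.θ.fst j - x.V j‖ ^ 2 :=
    ContDiff.norm_sq ℝ (by unfold State.V; fun_prop)
  unfold smoothPart g
  exact ((P.contDiff_loss.comp hθ).add (ContDiff.sum fun q _ => ContDiff.sum fun i _ =>
    contDiff_const.mul (hh q i))).add (ContDiff.sum fun j _ => contDiff_const.mul (hV j))

theorem hasGradientAt_smoothPart (x : State l n d) :
    HasGradientAt P.smoothPart (gradient P.smoothPart x) x :=
  (P.contDiff_smoothPart.differentiable (by norm_num) x).hasGradientAt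

theorem continuous_gradient_smoothPart : Continuous (gradient P.smoothPart) :=
  (LinearIsometryEquiv.continuous _).comp (P.contDiff_smoothPart.continuous_fderiv (by norm_num))

section PartialGradients

variable (h : ∀ (_ : Fin n) (i : Fin l), Vec (d i.castSucc.succ))
  (V : ∀ j : Fin (l + 1), Mat (d j.succ) (d j.castSucc)) (θ : ThetaSpace l d)

theorem hasGradientAt_g_update_h (q : Fin n) (i : Fin l) (y : Vec (d i.castSucc.succ)) :
    HasGradientAt (fun y => P.g (Function.update h q (Function.update (h q) i y)) V θ)
      ((P.μh i)⁻¹ • (y - P.z θ q i)) y :=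
  hasGradientAt_add_const (hasGradientAt_const_add (hasGradientAt_sum_update
    (φ := fun q (a : ∀ i : Fin l, Vec (d i.castSucc.succ)) =>
      ∑ i, 1 / (2 * P.μh i) * ‖P.z θ q i - a i‖ ^ 2)
    (hasGradientAt_sum_update (φ := fun i a => 1 / (2 * P.μh i) * ‖P.z θ q i - a‖ ^ 2)
      (hasGradientAt_quadratic (P.μh i) (P.z θ q i) y) (h q)) h) _) _

theorem hasGradientAt_g_update_V (j : Fin (l + 1)) (Y : Mat (d j.succ) (d j.castSucc)) :
    HasGradientAt (fun Y => P.g h (Function.update V j Y) θ) ((P.μv j)⁻¹ • (Y - θ.fst j)) Y :=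
  hasGradientAt_const_add (hasGradientAt_sum_update
    (φ := fun j Y => 1 / (2 * P.μv j) * ‖θ.fst j - Y‖ ^ 2)
    (hasGradientAt_quadratic (P.μv j) (θ.fst j) Y) V) _

theorem hasGradientAt_g_θ (x : State l n d) (t : ThetaSpace l d) :
    HasGradientAt (fun u => P.g x.h x.V u) (gradient P.smoothPart (x.withθ t)).θ t :=
  hasGradientAt_toLp_snd (hasGradientAt_toLp_snd (P.hasGradientAt_smoothPart (x.withθ t)))

end PartialGradients

theorem gradient_smoothPart_h (x : State l n d) (q : Fin n) (i : Fin l) :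
    (gradient P.smoothPart x).h q i = (P.μh i)⁻¹ • (x.h q i - P.z x.θ q i) := by
  have slice := hasGradientAt_toLp_update (hasGradientAt_toLp_update
    (hasGradientAt_toLp_fst (P.hasGradientAt_smoothPart x)) q) i
  have blocks_eq (y : Vec (d i.castSucc.succ)) :
      State.h (WithLp.toLp 2 (WithLp.toLp 2 (Function.update (⇑x.fst) q
        (WithLp.toLp 2 (Function.update (⇑(x.fst q)) i y))), x.snd))
      = Function.update x.h q (Function.update (x.h q) i y) :=
    funext (Function.apply_update
      (fun _ (a : PiLp 2 fun i : Fin l => Vec (d i.castSucc.succ)) => a.ofLp) x.fst.ofLp q _)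
  simp only [smoothPart, blocks_eq] at slice
  exact slice.unique (P.hasGradientAt_g_update_h x.h x.V x.θ q i (x.h q i))

theorem gradient_smoothPart_V (x : State l n d) (j : Fin (l + 1)) :
    (gradient P.smoothPart x).V j = (P.μv j)⁻¹ • (x.V j - x.θ.fst j) :=
  (hasGradientAt_toLp_update (hasGradientAt_toLp_fst
    (hasGradientAt_toLp_snd (P.hasGradientAt_smoothPart x))) j).unique
    (P.hasGradientAt_g_update_V x.h x.V x.θ j (x.V j))

theorem convexOn_rh (i : Fin l) : ConvexOn ℝ Set.univ (P.rh i) := by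
  have convexOn_l1 : ConvexOn ℝ Set.univ
      (∑ a, fun y : Vec (d i.castSucc.succ) => |y a|) :=
    Finset.sum_induction _ (ConvexOn ℝ Set.univ) (fun _ _ => ConvexOn.add)
      (convexOn_const 0 convex_univ) fun a _ =>
        convexOn_univ_norm.comp_linearMap (EuclideanSpace.projₗ a)
  rw [Finset.sum_fn] at convexOn_l1
  exact convexOn_l1.smul (P.α_nonneg i)

theorem convexOn_rv (j : Fin (l + 1)) : ConvexOn ℝ Set.univ (P.rv j) :=
  convexOn_nuclearNorm.smul (P.β_nonneg j)

@[fun_prop]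
theorem continuous_rh (i : Fin l) : Continuous (P.rh i) := by
  unfold rh
  fun_prop

@[fun_prop]
theorem continuous_rv (j : Fin (l + 1)) : Continuous (P.rv j) :=
  continuous_const.mul continuous_nuclearNorm

theorem rh_nonneg (i : Fin l) (y : Vec (d i.castSucc.succ)) : 0 ≤ P.rh i y :=
  mul_nonneg (P.α_nonneg i) (Finset.sum_nonneg fun _ _ => abs_nonneg _)

theorem rv_nonneg (j : Fin (l + 1)) (Y : Mat (d j.succ) (d j.castSucc)) : 0 ≤ P.rv j Y :=
  mul_nonneg (P.β_nonneg j) (nuclearNorm_nonneg Y)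

theorem box_eq_iInter_preimage :
    P.box = (⋂ j, ⋂ e, (fun θ : ThetaSpace l d => θ.fst j e) ⁻¹' Set.Icc (-P.M) P.M) ∩
      ⋂ j, ⋂ a, (fun θ : ThetaSpace l d => θ.snd j a) ⁻¹' Set.Icc (-P.M) P.M := by
  ext θ
  simp only [box, Set.mem_inter_iff, Set.mem_iInter, Set.mem_preimage, Set.mem_Icc, ← abs_le,
    Set.mem_ofPred_eq]

theorem isClosed_box : IsClosed P.box := by
  rw [box_eq_iInter_preimage]
  exact .inter
    (isClosed_iInter fun j => isClosed_iInter fun e => isClosed_Icc.preimage (by fun_prop))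
    (isClosed_iInter fun j => isClosed_iInter fun a => isClosed_Icc.preimage (by fun_prop))

theorem convex_box : Convex ℝ P.box := by
  rw [box_eq_iInter_preimage]
  exact (convex_iInter fun j => convex_iInter fun e => (convex_Icc _ _).is_linear_preimage
    ⟨fun _ _ => rfl, fun _ _ => rfl⟩).inter (convex_iInter fun j => convex_iInter fun a =>
      (convex_Icc _ _).is_linear_preimage ⟨fun _ _ => rfl, fun _ _ => rfl⟩)

theorem zero_mem_box : (0 : ThetaSpace l d) ∈ P.box := by
  constructor <;> intros <;> simpa using P.M_pos.le

theorem rθ_of_mem {θ : ThetaSpace l d} (h : θ ∈ P.box) : P.rθ θ = 0 := if_pos h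

theorem rθ_of_notMem {θ : ThetaSpace l d} (h : θ ∉ P.box) : P.rθ θ = ⊤ := if_neg h

theorem mem_box_of_isProx {σ : ℝ} {x y : ThetaSpace l d} (h : IsProx P.rθ σ x y) : y ∈ P.box := by
  by_contra hy
  have := h 0
  rw [P.rθ_of_notMem hy, P.rθ_of_mem P.zero_mem_box, EReal.top_add_coe, zero_add,
    top_le_iff] at this
  exact EReal.coe_ne_top _ this

/-- The regularizers of the blocks `h` and `V`, i.e. the real-valued nonsmooth part of `Q`. -/
def blockReg (x : State l n d) : ℝ := (∑ q, ∑ i, P.rh i (x.h q i)) + ∑ j, P.rv j (x.V j)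

@[fun_prop]
theorem continuous_blockReg : Continuous P.blockReg := by
  unfold blockReg
  fun_prop

theorem blockReg_nonneg (x : State l n d) : 0 ≤ P.blockReg x :=
  add_nonneg (Finset.sum_nonneg fun _ _ => Finset.sum_nonneg fun i _ => P.rh_nonneg i _)
    (Finset.sum_nonneg fun j _ => P.rv_nonneg j _)

theorem smoothPart_nonneg (x : State l n d) : 0 ≤ P.smoothPart x := by
  have loss_nonneg : 0 ≤ P.loss x.θ :=
    add_nonneg (Finset.sum_nonneg fun _ _ => sq_nonneg _)
      (mul_nonneg P.lam_pos.le (Finset.sum_nonneg fun _ _ => sq_nonneg _))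
  exact add_nonneg (add_nonneg loss_nonneg (Finset.sum_nonneg fun _ _ => Finset.sum_nonneg
    fun i _ => penalty_nonneg (P.μh_pos i) _)) (Finset.sum_nonneg fun j _ =>
      penalty_nonneg (P.μv_pos j) _)

theorem Q_eq (x : State l n d) : P.Q x = P.smoothPart x + (P.blockReg x + P.rθ x.θ) := by
  rw [Q, add_assoc (P.g _ _ _), EReal.coe_add, add_assoc]
  rfl

/-- The squared distance between the blocks `h` and `V` of two states, weighted like the quadratic
penalties of `g`; it measures the decrease achieved by the `h`- and `V`-updates. -/
def blockDistSq (x y : State l n d) : ℝ :=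
  (∑ q, ∑ i, 1 / (2 * P.μh i) * ‖x.h q i - y.h q i‖ ^ 2)
    + ∑ j, 1 / (2 * P.μv j) * ‖x.V j - y.V j‖ ^ 2

theorem penalty_h_le_blockDistSq (x y : State l n d) (q : Fin n) (i : Fin l) :
    1 / (2 * P.μh i) * ‖x.h q i - y.h q i‖ ^ 2 ≤ P.blockDistSq x y := by
  have term_nonneg (q i) : 0 ≤ 1 / (2 * P.μh i) * ‖x.h q i - y.h q i‖ ^ 2 :=
    penalty_nonneg (P.μh_pos i) _
  calc _ ≤ ∑ i, 1 / (2 * P.μh i) * ‖x.h q i - y.h q i‖ ^ 2 :=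
        Finset.single_le_sum (fun i _ => term_nonneg q i) (Finset.mem_univ i)
    _ ≤ ∑ q, ∑ i, 1 / (2 * P.μh i) * ‖x.h q i - y.h q i‖ ^ 2 :=
        Finset.single_le_sum (f := fun q => ∑ i, 1 / (2 * P.μh i) * ‖x.h q i - y.h q i‖ ^ 2)
          (fun q _ => Finset.sum_nonneg fun i _ => term_nonneg q i) (Finset.mem_univ q)
    _ ≤ _ := le_add_of_nonneg_right <| Finset.sum_nonneg fun j _ => penalty_nonneg (P.μv_pos j) _

theorem penalty_V_le_blockDistSq (x y : State l n d) (j : Fin (l + 1)) :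
    1 / (2 * P.μv j) * ‖x.V j - y.V j‖ ^ 2 ≤ P.blockDistSq x y :=
  (Finset.single_le_sum (fun j _ => penalty_nonneg (P.μv_pos j) (x.V j - y.V j))
    (Finset.mem_univ j)).trans <| le_add_of_nonneg_left <| Finset.sum_nonneg fun _ _ =>
      Finset.sum_nonneg fun i _ => penalty_nonneg (P.μh_pos i) _

theorem blockDistSq_nonneg (x y : State l n d) : 0 ≤ P.blockDistSq x y :=
  (penalty_nonneg (P.μv_pos 0) _).trans (P.penalty_V_le_blockDistSq x y 0)

theorem isCriticalPt_of_blockwise {x : State l n d} (hx : x.θ ∈ P.box)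
    (hh : ∀ q i u, P.rh i (x.h q i)
      + inner ℝ (-(gradient P.smoothPart x).h q i) (u - x.h q i) ≤ P.rh i u)
    (hV : ∀ j U, P.rv j (x.V j)
      + inner ℝ (-(gradient P.smoothPart x).V j) (U - x.V j) ≤ P.rv j U)
    (hθ : ∀ u ∈ P.box, inner ℝ (-(gradient P.smoothPart x).θ) (u - x.θ) ≤ 0) :
    IsCriticalPt P.Q x := by
  have neg_gradient_mem : -gradient P.smoothPart x ∈
      frechetSubdiff (fun y => (P.blockReg y : EReal) + P.rθ y.θ) x := by
    have finite : (P.blockReg x : EReal) + P.rθ x.θ = P.blockReg x := by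
      rw [P.rθ_of_mem hx, add_zero]
    refine mem_frechetSubdiff_of_forall_le (finite.trans_ne (EReal.coe_ne_top _))
      (finite.trans_ne (EReal.coe_ne_bot _)) fun y => ?_
    by_cases hy : y.θ ∈ P.box
    · rw [finite, P.rθ_of_mem hy, add_zero, ← EReal.coe_add, EReal.coe_le_coe_iff,
        State.inner_eq_sum_blocks]
      have sum_h := Finset.sum_le_sum fun q (_ : q ∈ Finset.univ) =>
        Finset.sum_le_sum fun i (_ : i ∈ Finset.univ) => hh q i (y.h q i)
      have sum_V := Finset.sum_le_sum fun j (_ : j ∈ Finset.univ) => hV j (y.V j)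
      simp only [Finset.sum_add_distrib] at sum_h sum_V
      have := add_le_add (add_le_add sum_h sum_V) (hθ _ hy)
      rw [add_zero, add_add_add_comm, add_assoc] at this
      exact this
    · rw [P.rθ_of_notMem hy, EReal.coe_add_top]
      exact le_top
  have := add_mem_frechetSubdiff (P.hasGradientAt_smoothPart x) neg_gradient_mem
  rw [add_neg_cancel, ← funext P.Q_eq] at this
  exact frechetSubdiff_subset_limitingSubdiff this

end Model

end Model

section RealSequences

theorem tendsto_zero_of_add_le {Φ D : ℕ → ℝ} (hΦ : ∀ k, 0 ≤ Φ k) (hD : ∀ k, 0 ≤ D k)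
    (h : ∀ k, Φ (k + 1) + D k ≤ Φ k) : Tendsto D atTop (𝓝 0) := by
  have hanti : Antitone Φ := antitone_nat_of_succ_le fun k => by linarith [h k, hD k]
  have hlim := tendsto_atTop_ciInf hanti ⟨0, Set.forall_mem_range.2 hΦ⟩
  have hdiff := hlim.sub (hlim.comp (tendsto_add_atTop_nat 1))
  rw [sub_self] at hdiff
  exact squeeze_zero hD (fun k => le_sub_iff_add_le'.2 (h k)) hdiff

theorem tendsto_zero_of_mul_norm_sq_le {ι E : Type*} [SeminormedAddCommGroup E] {u : Filter ι}
    {a b : ι → ℝ} {v : ι → E} {c : ℝ} (hc : 0 < c) (ha : ∀ k, c ≤ a k)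
    (h : ∀ k, a k * ‖v k‖ ^ 2 ≤ b k) (hb : Tendsto b u (𝓝 0)) : Tendsto v u (𝓝 0) := by
  have hsqrt : Tendsto (fun k => √(b k / c)) u (𝓝 0) := by
    simpa using (hb.div_const c).sqrt
  refine squeeze_zero_norm (fun k => Real.le_sqrt_of_sq_le ((le_div_iff₀' hc).2 ?_)) hsqrt
  exact (mul_le_mul_of_nonneg_right (ha k) (sq_nonneg _)).trans (h k)

end RealSequences

section Model

variable {l n : ℕ} {d : Fin (l + 2) → ℕ} {P : Model l n d}

namespace StepRule

section Inertia

variable (S : StepRule P) (ξ : ℕ → State l n d) (k : ℕ)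

theorem γ_pos : 0 < S.γ := zero_lt_one.trans S.one_lt_γ

theorem μθ_pos : 0 < S.μθ k := S.μθMin_pos.trans_le (S.μθ_mem k).1

theorem μθMax_pos : 0 < S.μθMax := (S.μθ_pos 0).trans_le (S.μθ_mem 0).2

theorem sh_pos (i : Fin l) : 0 < S.sh k i := (S.shMin_pos i).trans_le (S.sh_mem k i).1

theorem sv_pos (j : Fin (l + 1)) : 0 < S.sv k j := (S.svMin_pos j).trans_le (S.sv_mem k j).1

theorem one_div_le_L : 1 / (S.γ * S.μθMax) ≤ S.L k := by
  have hγ := S.γ_pos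
  have hL := S.L_pos k
  have hmax := S.μθMax_pos
  have h := (S.μθ_mem k).2
  rw [div_le_iff₀ (by positivity)] at h ⊢
  linarith

theorem one_div_L_pos : 0 < 1 / (S.γ * S.μθMax) :=
  one_div_pos.2 (mul_pos S.γ_pos S.μθMax_pos)

/-- The multiple of the last squared increment of `θ` which, added to the objective, gives a
Lyapunov function of the extrapolated method. -/
def inertia : ℝ := (S.γ - 1) / 4 * S.L k * ‖(ξ k).θ - (ξ (k - 1)).θ‖ ^ 2

theorem inertia_nonneg : 0 ≤ S.inertia ξ k := by
  have hγ := sub_pos.2 S.one_lt_γ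
  have hL := S.L_pos k
  unfold inertia
  positivity

theorem ω_sq_le : S.ω (k + 1) ^ 2
    ≤ ((S.γ - 1) / (2 * (S.γ + 1))) ^ 2 * (S.δmax * (S.L k / S.L (k + 1))) := by
  have hratio : 0 ≤ S.L k / S.L (k + 1) := (div_pos (S.L_pos k) (S.L_pos (k + 1))).le
  have h := pow_le_pow_left₀ (S.ω_nonneg (k + 1)) (S.ω_le k) 2
  rw [mul_pow, Real.sq_sqrt (mul_nonneg (S.δ_mem (k + 1)).1 hratio)] at h
  refine h.trans ?_
  gcongr
  exact (S.δ_mem (k + 1)).2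

theorem extrapolation_error_le_inertia :
    (S.γ + 1) ^ 2 / (S.γ - 1) * (S.L (k + 1) * ‖S.hat ξ k - (ξ k).θ‖ ^ 2)
      ≤ S.δmax * S.inertia ξ k := by
  have hγ := sub_pos.2 S.one_lt_γ
  have hγ' : 0 < S.γ + 1 := by linarith
  have hL := S.L_pos (k + 1)
  rw [hat, add_sub_cancel_left, norm_smul, mul_pow, Real.norm_eq_abs, sq_abs, inertia]
  calc _ ≤ (S.γ + 1) ^ 2 / (S.γ - 1) * (S.L (k + 1) * (((S.γ - 1) / (2 * (S.γ + 1))) ^ 2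
        * (S.δmax * (S.L k / S.L (k + 1))) * ‖(ξ k).θ - (ξ (k - 1)).θ‖ ^ 2)) := by
        gcongr
        exact S.ω_sq_le k
    _ = _ := by
        field_simp
        ring

theorem gradθ_eq (t : ThetaSpace l d) :
    gradθ P ξ k t = (gradient P.smoothPart ((ξ (k + 1)).withθ t)).θ :=
  (P.hasGradientAt_g_θ (ξ (k + 1)) t).gradient

end Inertia

namespace IsGenerated

variable {S : StepRule P} {ξ : ℕ → State l n d} (hξ : S.IsGenerated ξ)

include hξ

theorem h_variational_inequality (k : ℕ) (q : Fin n) (i : Fin l) (u : Vec (d i.castSucc.succ)) :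
    P.rh i ((ξ (k + 1)).h q i)
      + inner ℝ ((ξ k).h q i - S.sh (k + 1) i • (gradient P.smoothPart (ξ k)).h q i
        - (ξ (k + 1)).h q i) (u - (ξ (k + 1)).h q i) / S.sh (k + 1) i ≤ P.rh i u := by
  have h := hξ.h_step k q i
  unfold mixH at h
  rw [(P.hasGradientAt_g_update_h ..).gradient, ← P.gradient_smoothPart_h] at h
  exact h.variational_inequality (P.convexOn_rh i) (fun _ _ => rfl) trivial trivial

theorem V_variational_inequality (k : ℕ) (j : Fin (l + 1)) (U : Mat (d j.succ) (d j.castSucc)) :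
    P.rv j ((ξ (k + 1)).V j)
      + inner ℝ ((ξ k).V j - S.sv (k + 1) j • (gradient P.smoothPart (ξ k)).V j
        - (ξ (k + 1)).V j) (U - (ξ (k + 1)).V j) / S.sv (k + 1) j ≤ P.rv j U := by
  have h := hξ.V_step k j
  unfold mixV at h
  rw [(P.hasGradientAt_g_update_V ..).gradient, ← P.gradient_smoothPart_V] at h
  exact h.variational_inequality (P.convexOn_rv j) (fun _ _ => rfl) trivial trivial

theorem θ_succ_mem_box (k : ℕ) : (ξ (k + 1)).θ ∈ P.box :=
  P.mem_box_of_isProx (hξ.θ_step k)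

theorem θ_variational_inequality (k : ℕ) {u : ThetaSpace l d} (hu : u ∈ P.box) :
    inner ℝ (S.hat ξ k - S.μθ (k + 1) • gradθ P ξ k (S.hat ξ k) - (ξ (k + 1)).θ)
      (u - (ξ (k + 1)).θ) / S.μθ (k + 1) ≤ 0 := by
  have := (hξ.θ_step k).variational_inequality (convexOn_const 0 P.convex_box)
    (fun _ h => P.rθ_of_mem h) (hξ.θ_succ_mem_box k) hu
  rwa [zero_add] at this

theorem block_steps_decrease (k : ℕ) :
    P.smoothPart ((ξ (k + 1)).withθ (ξ k).θ) + P.blockReg (ξ (k + 1))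
      + P.blockDistSq (ξ (k + 1)) (ξ k) ≤ P.smoothPart (ξ k) + P.blockReg (ξ k) := by
  have h_decrease := Finset.sum_le_sum fun q (_ : q ∈ Finset.univ) =>
    Finset.sum_le_sum fun i (_ : i ∈ Finset.univ) =>
      quadratic_prox_gradient_step_le (z := P.z (ξ k).θ q i) (S.sh_pos (k + 1) i)
        (S.sh_mem (k + 1) i).2 <| by
          simpa only [P.gradient_smoothPart_h] using hξ.h_variational_inequality k q i _
  have V_decrease := Finset.sum_le_sum fun j (_ : j ∈ Finset.univ) =>
    quadratic_prox_gradient_step_le (z := (ξ k).θ.fst j) (S.sv_pos (k + 1) j)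
      (S.sv_mem (k + 1) j).2 <| by
        simpa only [P.gradient_smoothPart_V] using hξ.V_variational_inequality k j _
  simp only [Finset.sum_add_distrib] at h_decrease V_decrease
  have smoothPart_withθ : P.smoothPart ((ξ (k + 1)).withθ (ξ k).θ) = P.loss (ξ k).θ
      + (∑ q, ∑ i, 1 / (2 * P.μh i) * ‖P.z (ξ k).θ q i - (ξ (k + 1)).h q i‖ ^ 2)
      + ∑ j, 1 / (2 * P.μv j) * ‖(ξ k).θ.fst j - (ξ (k + 1)).V j‖ ^ 2 := rfl
  rw [smoothPart_withθ, Model.smoothPart, Model.g, Model.blockReg, Model.blockReg,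
    Model.blockDistSq]
  linarith

theorem θ_step_decrease {k : ℕ} (hk : (ξ k).θ ∈ P.box) :
    P.smoothPart (ξ (k + 1)) + S.inertia ξ (k + 1)
      ≤ P.smoothPart ((ξ (k + 1)).withθ (ξ k).θ) + S.δmax * S.inertia ξ k :=
  (extrapolated_projected_gradient_step_le P.convex_box
    (fun t _ => (P.hasGradientAt_g_θ (ξ (k + 1)) t).differentiableAt.hasGradientAt)
    (S.L_pos (k + 1)) S.one_lt_γ (hξ.lipschitz k) hk (hξ.θ_succ_mem_box k)
    (hξ.θ_variational_inequality k hk)).trans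
      (add_le_add_right (S.extrapolation_error_le_inertia ξ k) _)

theorem tendsto_decrement :
    Tendsto (fun k => P.blockDistSq (ξ (k + 1)) (ξ k) + (1 - S.δmax) * S.inertia ξ k)
      atTop (𝓝 0) := by
  rw [← tendsto_add_atTop_iff_nat 1]
  refine tendsto_zero_of_add_le
    (Φ := fun k => P.smoothPart (ξ (k + 1)) + P.blockReg (ξ (k + 1)) + S.inertia ξ (k + 1))
    (fun k => ?_) (fun k => ?_) fun k => ?_
  · exact add_nonneg (add_nonneg (P.smoothPart_nonneg _) (P.blockReg_nonneg _))
      (S.inertia_nonneg ξ _)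
  · exact add_nonneg (P.blockDistSq_nonneg _ _)
      (mul_nonneg (sub_pos.2 S.δmax_lt_one).le (S.inertia_nonneg ξ _))
  · linarith [hξ.block_steps_decrease (k + 1), hξ.θ_step_decrease (hξ.θ_succ_mem_box k)]

theorem tendsto_blockDistSq :
    Tendsto (fun k => P.blockDistSq (ξ (k + 1)) (ξ k)) atTop (𝓝 0) :=
  squeeze_zero (fun _ => P.blockDistSq_nonneg _ _) (fun k => le_add_of_nonneg_right
    (mul_nonneg (sub_pos.2 S.δmax_lt_one).le (S.inertia_nonneg ξ k))) hξ.tendsto_decrement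

theorem tendsto_inertia : Tendsto (S.inertia ξ) atTop (𝓝 0) := by
  have hδ : 0 < 1 - S.δmax := sub_pos.2 S.δmax_lt_one
  refine squeeze_zero (S.inertia_nonneg ξ) (fun k => (le_div_iff₀' hδ).2 ?_)
    (by simpa using hξ.tendsto_decrement.div_const (1 - S.δmax))
  exact le_add_of_nonneg_left (P.blockDistSq_nonneg _ _)

theorem tendsto_h_sub_succ (q : Fin n) (i : Fin l) :
    Tendsto (fun k => (ξ k).h q i - (ξ (k + 1)).h q i) atTop (𝓝 0) := by
  have hc : 0 < 1 / (2 * P.μh i) := one_div_pos.2 (mul_pos two_pos (P.μh_pos i))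
  refine tendsto_zero_of_mul_norm_sq_le hc (fun _ => le_rfl) (fun k => ?_) hξ.tendsto_blockDistSq
  rw [norm_sub_rev]
  exact P.penalty_h_le_blockDistSq _ _ q i

theorem tendsto_V_sub_succ (j : Fin (l + 1)) :
    Tendsto (fun k => (ξ k).V j - (ξ (k + 1)).V j) atTop (𝓝 0) := by
  have hc : 0 < 1 / (2 * P.μv j) := one_div_pos.2 (mul_pos two_pos (P.μv_pos j))
  refine tendsto_zero_of_mul_norm_sq_le hc (fun _ => le_rfl) (fun k => ?_) hξ.tendsto_blockDistSq
  rw [norm_sub_rev]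
  exact P.penalty_V_le_blockDistSq _ _ j

theorem tendsto_θ_sub_succ :
    Tendsto (fun k => (ξ k).θ - (ξ (k + 1)).θ) atTop (𝓝 0) := by
  have hγ : 0 < (S.γ - 1) / 4 := div_pos (sub_pos.2 S.one_lt_γ) four_pos
  refine tendsto_zero_of_mul_norm_sq_le (mul_pos hγ S.one_div_L_pos)
    (fun k => mul_le_mul_of_nonneg_left (S.one_div_le_L (k + 1)) hγ.le) (fun k => ?_)
    ((tendsto_add_atTop_iff_nat 1).2 hξ.tendsto_inertia)
  rw [norm_sub_rev]
  rfl

theorem tendsto_hat_sub : Tendsto (fun k => S.hat ξ k - (ξ k).θ) atTop (𝓝 0) := by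
  have hγ : 0 < (S.γ + 1) ^ 2 / (S.γ - 1) :=
    div_pos (pow_pos (add_pos S.γ_pos one_pos) 2) (sub_pos.2 S.one_lt_γ)
  refine tendsto_zero_of_mul_norm_sq_le (mul_pos hγ S.one_div_L_pos)
    (fun k => mul_le_mul_of_nonneg_left (S.one_div_le_L (k + 1)) hγ.le) (fun k => ?_)
    (by simpa using hξ.tendsto_inertia.const_mul S.δmax)
  rw [mul_assoc]
  exact S.extrapolation_error_le_inertia ξ k

theorem eventually_θ_mem_box : ∀ᶠ k in atTop, (ξ k).θ ∈ P.box := by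
  filter_upwards [eventually_ge_atTop 1] with k hk
  rw [← Nat.sub_add_cancel hk]
  exact hξ.θ_succ_mem_box (k - 1)

section LimitPoint

variable {u : Filter ℕ} (hu : u ≤ atTop) {x : State l n d} (hx : Tendsto ξ u (𝓝 x))

include hu hx

theorem tendsto_succ : Tendsto (fun k => ξ (k + 1)) u (𝓝 x) := by
  have block {E : Type} [NormedAddCommGroup E] {f : State l n d → E} (hf : Continuous f)
      (h : Tendsto (fun k => f (ξ k) - f (ξ (k + 1))) atTop (𝓝 0)) :
      Tendsto (fun k => f (ξ (k + 1))) u (𝓝 (f x)) := by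
    simpa using ((hf.tendsto x).comp hx).sub (h.mono_left hu)
  exact State.tendsto_of_blocks
    (fun q i => block (State.continuous_h q i) (hξ.tendsto_h_sub_succ q i))
    (fun j => block (State.continuous_V j) (hξ.tendsto_V_sub_succ j))
    (block State.continuous_θ hξ.tendsto_θ_sub_succ)

theorem tendsto_hat : Tendsto (S.hat ξ) u (𝓝 x.θ) := by
  simpa using (hξ.tendsto_hat_sub.mono_left hu).add ((State.continuous_θ.tendsto x).comp hx)

theorem tendsto_gradθ_hat :
    Tendsto (fun k => gradθ P ξ k (S.hat ξ k)) u (𝓝 (gradient P.smoothPart x).θ) := by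
  simp only [gradθ_eq]
  have hwith : Tendsto (fun k => (ξ (k + 1)).withθ (S.hat ξ k)) u (𝓝 x) :=
    (State.continuous_withθ.tendsto (x, x.θ)).comp
      ((hξ.tendsto_succ hu hx).prodMk_nhds (hξ.tendsto_hat hu hx))
  exact ((State.continuous_θ.comp P.continuous_gradient_smoothPart).tendsto x).comp hwith

variable [u.NeBot]

theorem θ_mem_box_of_tendsto : x.θ ∈ P.box :=
  P.isClosed_box.mem_of_tendsto ((State.continuous_θ.tendsto x).comp hx)
    (hu hξ.eventually_θ_mem_box)

theorem isCriticalPt_of_tendsto : IsCriticalPt P.Q x := by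
  have block_gradient {E : Type} [TopologicalSpace E] {f : State l n d → E} (hf : Continuous f) :
      Tendsto (fun k => f (gradient P.smoothPart (ξ k))) u (𝓝 (f (gradient P.smoothPart x))) :=
    ((hf.comp P.continuous_gradient_smoothPart).tendsto x).comp hx
  refine P.isCriticalPt_of_blockwise (hξ.θ_mem_box_of_tendsto hu hx)
    (fun q i v => ?_) (fun j U => ?_) fun v hv => ?_
  · exact tendsto_prox_inequality (P.continuous_rh i).continuousAt (S.shMin_pos i)
      (fun k => (S.sh_mem (k + 1) i).1) (((State.continuous_h q i).tendsto x).comp hx)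
      ((hξ.tendsto_h_sub_succ q i).mono_left hu) (block_gradient (State.continuous_h q i))
      fun k => hξ.h_variational_inequality k q i v
  · exact tendsto_prox_inequality (P.continuous_rv j).continuousAt (S.svMin_pos j)
      (fun k => (S.sv_mem (k + 1) j).1) (((State.continuous_V j).tendsto x).comp hx)
      ((hξ.tendsto_V_sub_succ j).mono_left hu) (block_gradient (State.continuous_V j))
      fun k => hξ.V_variational_inequality k j U
  · have hat_sub_succ : Tendsto (fun k => S.hat ξ k - (ξ (k + 1)).θ) u (𝓝 0) := by
      simpa using (hξ.tendsto_hat_sub.add hξ.tendsto_θ_sub_succ).mono_left hu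
    have := tendsto_prox_inequality (r := 0) continuousAt_const S.μθMin_pos
      (fun k => (S.μθ_mem (k + 1)).1) (hξ.tendsto_hat hu hx) hat_sub_succ
      (hξ.tendsto_gradθ_hat hu hx) fun k => (zero_add _).trans_le (hξ.θ_variational_inequality k hv)
    simpa using this

theorem tendsto_rθ : Tendsto (fun k => P.rθ (ξ k).θ) u (𝓝 (P.rθ x.θ)) := by
  rw [P.rθ_of_mem (hξ.θ_mem_box_of_tendsto hu hx)]
  refine tendsto_const_nhds.congr' ?_
  filter_upwards [hu hξ.eventually_θ_mem_box] with k hk using (P.rθ_of_mem hk).symm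

theorem tendsto_Q : Tendsto (fun k => P.Q (ξ k)) u (𝓝 (P.Q x)) := by
  have hreal : Continuous fun y => P.smoothPart y + P.blockReg y :=
    P.contDiff_smoothPart.continuous.add P.continuous_blockReg
  have Q_of_mem {y : State l n d} (hy : y.θ ∈ P.box) :
      ((P.smoothPart y + P.blockReg y : ℝ) : EReal) = P.Q y := by
    rw [P.Q_eq, P.rθ_of_mem hy, add_zero, EReal.coe_add]
  rw [← Q_of_mem (hξ.θ_mem_box_of_tendsto hu hx)]
  refine ((continuous_coe_real_ereal.comp hreal).tendsto x |>.comp hx).congr' ?_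
  filter_upwards [hu hξ.eventually_θ_mem_box] with k hk using Q_of_mem hk

end LimitPoint

end IsGenerated

end StepRule

end Model

end DNNNSR

end

theorem theorem1 {l n : ℕ} {d : Fin (l + 2) → ℕ} (P : DNNNSR.Model l n d)
    (S : DNNNSR.StepRule P) (ξ : ℕ → DNNNSR.State l n d) (hξ : S.IsGenerated ξ)
    (hbdd : Bornology.IsBounded (Set.range ξ)) :
    -- (a) a limit point exists
    (∃ (x : DNNNSR.State l n d) (φ : ℕ → ℕ), StrictMono φ ∧
      Filter.Tendsto (fun m => ξ (φ m)) Filter.atTop (nhds x)) ∧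
    -- (b) the regularizers converge along every convergent subsequence
    (∀ (x : DNNNSR.State l n d) (φ : ℕ → ℕ), StrictMono φ →
      Filter.Tendsto (fun m => ξ (φ m)) Filter.atTop (nhds x) →
      (∀ q i, Filter.Tendsto (fun m => P.rh i ((ξ (φ m)).h q i)) Filter.atTop
        (nhds (P.rh i (x.h q i)))) ∧
      (∀ j, Filter.Tendsto (fun m => P.rv j ((ξ (φ m)).V j)) Filter.atTop
        (nhds (P.rv j (x.V j)))) ∧
      Filter.Tendsto (fun m => P.rθ (ξ (φ m)).θ) Filter.atTop (nhds (P.rθ x.θ))) ∧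
    -- (c) every limit point is a critical point
    (∀ (x : DNNNSR.State l n d) (φ : ℕ → ℕ), StrictMono φ →
      Filter.Tendsto (fun m => ξ (φ m)) Filter.atTop (nhds x) →
      DNNNSR.IsCriticalPt P.Q x) ∧
    -- (d) the objective converges along every convergent subsequence
    (∀ (x : DNNNSR.State l n d) (φ : ℕ → ℕ), StrictMono φ →
      Filter.Tendsto (fun m => ξ (φ m)) Filter.atTop (nhds x) →
      Filter.Tendsto (fun m => P.Q (ξ (φ m))) Filter.atTop (nhds (P.Q x))) := by
  have limit_filter {φ : ℕ → ℕ} (hφ : StrictMono φ) : atTop.map φ ≤ atTop := hφ.tendsto_atTop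
  refine ⟨?_, fun x φ hφ hx => ⟨fun q i => ?_, fun j => ?_, ?_⟩, fun x φ hφ hx => ?_,
    fun x φ hφ hx => ?_⟩
  · obtain ⟨x, -, φ, hφ, hx⟩ := tendsto_subseq_of_bounded hbdd fun k => Set.mem_range_self k
    exact ⟨x, φ, hφ, hx⟩
  · exact (((P.continuous_rh i).comp (DNNNSR.State.continuous_h q i)).tendsto x).comp hx
  · exact (((P.continuous_rv j).comp (DNNNSR.State.continuous_V j)).tendsto x).comp hx
  · exact tendsto_map'_iff.1 (hξ.tendsto_rθ (limit_filter hφ) (tendsto_map'_iff.2 hx))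
  · exact hξ.isCriticalPt_of_tendsto (limit_filter hφ) (tendsto_map'_iff.2 hx)
  · exact tendsto_map'_iff.1 (hξ.tendsto_Q (limit_filter hφ) (tendsto_map'_iff.2 hx))
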